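/- Let $n\ge 0$, $\mathbb T^n=\mathbb R^n/\mathbb Z^n$, and let $L:\mathbb T^n\times\mathbb R^n\to\mathbb R$ be a Lagrangian of class $C^2$ (when viewed as a function on $\mathbb R^n\times\mathbb R^n$ that is $\mathbb Z^n$-periodic in $x$; in particular, $L$ may be smooth) such that $D^2_{vv}L(x,v)\ge\gamma$ for all $(x,v)$, for some constant $\gamma>0$, and $\lim_{|v|\to\infty}L(x,v)/|v|=\infty$ for every $x$. Fix $Q\in\mathbb R^n$. For a Borel probability measure $\theta$ on $\mathbb T^n$ let $\Pi(\theta,Q)$ be the set of Markov kernels $\pi(x,dv)$ from $\mathbb T^n$ to $\mathbb R^n$ such that $$\int\big[\phi(x+v)-\phi(x)\big]\,\pi(x,dv)\,\theta(dx)=0\quad\text{for all }\phi\in C(\mathbb T^n),$$ $$\int|v|\,\pi(x,dv)\,\theta(dx)<\infty,\qquad \int v\,\pi(x,dv)\,\theta(dx)=Q,$$ and define the minimax value $$\hat L(Q)=\sup_\theta\ \inf_{\pi\in\Pi(\theta,Q)}\int L(x,v)\,\pi(x,dv)\,\theta(dx),$$ where the supremum is over all Borel probability measures $\theta$ on $\mathbb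 T^n$ and the integral takes values in $(-\infty,+\infty]$. Then $\hat L(Q)$ is finite and $$\hat L(Q)=\sup_{\theta}\ \sup_{P,u}\int_{\mathbb T^n}\inf_{v\in\mathbb R^n}\big[L(x,v)+u(x+v)-u(x)+P\cdot(v-Q)\big]\,\theta(dx),$$ where $\theta$ ranges over all Borel probability measures on $\mathbb T^n$, $P$ over $\mathbb R^n$, and $u$ over the continuous functions $\mathbb T^n\to\mathbb R$. -/

import Mathlib

open MeasureTheory ProbabilityTheory Filter
open scoped ENNReal

namespace MinimaxMather

/-- `ℝⁿ` with its Euclidean structure. -/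
abbrev E (n : ℕ) : Type := EuclideanSpace ℝ (Fin n)

/-- The torus `𝕋ⁿ = ℝⁿ / ℤⁿ`, with its compact product topology and Borel sigma-algebra. -/
abbrev Torus (n : ℕ) : Type := Fin n → UnitAddCircle

/-- The canonical projection `ℝⁿ → 𝕋ⁿ`. The point `x + v` of the torus, for `x ∈ 𝕋ⁿ` and
`v ∈ ℝⁿ`, is `x + proj v`. -/
def proj {n : ℕ} (v : E n) : Torus n := fun i => ((v i : ℝ) : UnitAddCircle)

/-- The hypotheses on a Lagrangian `L : 𝕋ⁿ × ℝⁿ → ℝ`. -/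
structure IsLagrangian {n : ℕ} (L : Torus n → E n → ℝ) : Prop where
  /-- `L`, seen as a `ℤⁿ`-periodic function of `x ∈ ℝⁿ`, is of class `C²` in `(x, v)`. -/
  smooth : ContDiff ℝ 2 (fun p : E n × E n => L (proj p.1) p.2)
  /-- `D²_{vv} L ≥ γ > 0`. -/
  convex : ∃ γ : ℝ, 0 < γ ∧ ∀ (x : Torus n) (v w : E n),
    γ * ‖w‖ ^ 2 ≤ iteratedFDeriv ℝ 2 (L x) v ![w, w]
  /-- `L(x, v) / |v| → ∞` as `|v| → ∞`. -/
  coercive : ∀ x : Torus n, Tendsto (fun v : E n => L x v / ‖v‖) (cocompact (E n)) atTop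

/-- The integral, with values in `[-∞, ∞]`, of an extended real function: the integral of its
positive part minus the integral of its negative part. It has its usual meaning whenever one of
these two integrals is finite, in particular for every measurable function that is bounded below,
when the measure is finite. -/
noncomputable def extIntegral {α : Type*} [MeasurableSpace α] (μ : Measure α) (f : α → EReal) :
    EReal :=
  ((∫⁻ a, (f a).toENNReal ∂μ : ℝ≥0∞) : EReal) - ((∫⁻ a, (-f a).toENNReal ∂μ : ℝ≥0∞) : EReal)

/-- `π ∈ Π(θ, Q)`: the kernel `π(x, dv)` consists of probability measures on `ℝⁿ`, and the measure
`π(x, dv) θ(dx)` satisfies the holonomic constraint and has rotation vector `Q`. -/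
structure IsPlan {n : ℕ} (θ : ProbabilityMeasure (Torus n)) (Q : E n)
    (π : Kernel (Torus n) (E n)) : Prop where
  markov : IsMarkovKernel π
  holonomic : ∀ φ : C(Torus n, ℝ),
    ∫ p, (φ (p.1 + proj p.2) - φ p.1) ∂((θ : Measure (Torus n)) ⊗ₘ π) = 0
  integrable : Integrable (fun p : Torus n × E n => p.2) ((θ : Measure (Torus n)) ⊗ₘ π)
  rotation : ∫ p, p.2 ∂((θ : Measure (Torus n)) ⊗ₘ π) = Q

/-- `g_Q(θ) = inf { ∫ L(x,v) π(x,dv) θ(dx) : π ∈ Π(θ, Q) }`. -/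
noncomputable def g {n : ℕ} (L : Torus n → E n → ℝ) (Q : E n) (θ : ProbabilityMeasure (Torus n)) :
    EReal :=
  ⨅ (π : Kernel (Torus n) (E n)) (_ : IsPlan θ Q π),
    extIntegral ((θ : Measure (Torus n)) ⊗ₘ π) (fun p => ((L p.1 p.2 : ℝ) : EReal))

/-- The minimax value `L̂(Q) = sup_θ g_Q(θ)`, over all Borel probability measures on `𝕋ⁿ`. -/
noncomputable def hatL {n : ℕ} (L : Torus n → E n → ℝ) (Q : E n) : EReal :=
  ⨆ θ : ProbabilityMeasure (Torus n), g L Q θ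

end MinimaxMather

/-! No exchange of infimum and supremum over `θ` is needed: the two sides agree for each fixed `θ`,
as the primal and dual values of a linear program (`dualValue_eq_g`).

One inequality is weak duality, since the constraint function integrates to zero along every plan
(`dualValue_le_g`). For the other, let `D` be the dual value. On the functions φ(x) + constraint + c
L, prescribe the value ∫ φ dθ + c D. This is nonnegative at nonnegative functions
(`nonneg_of_combination_nonneg`), so M. Riesz extension gives a positive functional on all functions
dominated by the weight L + K (`exists_positive_extension`), and Riesz–Markov–Kakutani gives a
measure (`exists_representing_measure`). Mass may escape as |v| → ∞, but `L` is superlinear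
uniformly in `x` (`superlinear`). Continuous functions of at most linear growth therefore keep their
exact value, so the constraints survive, while the integral of `L` can only drop, which is the
harmless direction. Disintegration over `θ` yields a plan of cost at most `D`.

Finiteness comes from a plan made of integer jumps, which is admissible for every `θ` at uniformly
bounded cost, and from the lower bound on `L`. -/

namespace MinimaxMather

open Topology

/-! ### Continuity and uniform superlinearity of the Lagrangian -/

variable {n : ℕ}

/-- Openness matters because open quotient maps are stable under products: continuity on 𝕋ⁿ × ℝⁿ can
then be tested on the periodic lift. -/
theorem isOpenQuotientMap_proj : IsOpenQuotientMap (proj : E n → Torus n) := by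
  have h : IsOpenQuotientMap
      (Pi.map fun _ : Fin n => ((↑) : ℝ → UnitAddCircle)) :=
    IsOpenQuotientMap.piMap fun _ => QuotientAddGroup.isOpenQuotientMap_mk
  exact h.comp (EuclideanSpace.equiv (Fin n) ℝ).toHomeomorph.isOpenQuotientMap

theorem continuous_proj : Continuous (proj : E n → Torus n) :=
  isOpenQuotientMap_proj.continuous

namespace IsLagrangian

variable {L : Torus n → E n → ℝ} (hL : IsLagrangian L)
include hL

theorem continuous_uncurry : Continuous (fun p : Torus n × E n => L p.1 p.2) := by
  rw [← (isOpenQuotientMap_proj.prodMap IsOpenQuotientMap.id).continuous_comp_iff]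
  exact hL.smooth.continuous

theorem contDiff (x : Torus n) : ContDiff ℝ 2 (L x) := by
  obtain ⟨y, rfl⟩ := isOpenQuotientMap_proj.surjective x
  exact hL.smooth.comp (contDiff_const.prodMk contDiff_id)

theorem convexOn_ray (x : Torus n) (w : E n) :
    ConvexOn ℝ Set.univ (fun t : ℝ => L x (t • w)) := by
  have h2 := hL.contDiff x
  have hd1 : ∀ t : ℝ, HasDerivAt (fun t : ℝ => L x (t • w)) (fderiv ℝ (L x) (t • w) w) t := by
    intro t
    have h := (h2.differentiable (by norm_num) (t • w)).hasFDerivAt.comp_hasDerivAt t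
      ((hasDerivAt_id t).smul_const w)
    rw [one_smul] at h
    exact h
  have hd2 : ∀ t : ℝ, HasDerivAt (fun t : ℝ => fderiv ℝ (L x) (t • w) w)
      (fderiv ℝ (fderiv ℝ (L x)) (t • w) w w) t := by
    intro t
    have h1 : Differentiable ℝ (fderiv ℝ (L x)) :=
      (h2.fderiv_right (m := 1) (by norm_num)).differentiable (by norm_num)
    have h := (h1 (t • w)).hasFDerivAt.comp_hasDerivAt t
      ((hasDerivAt_id t).smul_const w)
    have h' := h.clm_apply (hasDerivAt_const t w)
    simpa using h'
  have e1 : deriv (fun t : ℝ => L x (t • w)) = fun t => fderiv ℝ (L x) (t • w) w :=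
    funext fun t => (hd1 t).deriv
  refine convexOn_univ_of_deriv2_nonneg (fun t => (hd1 t).differentiableAt) ?_ ?_
  · rw [e1]; exact fun t => (hd2 t).differentiableAt
  · intro t
    simp only [Function.iterate_succ, Function.iterate_zero, Function.comp_apply, id]
    rw [e1, (hd2 t).deriv]
    obtain ⟨γ, hγ, h⟩ := hL.convex
    have := h x (t • w) w
    rw [iteratedFDeriv_two_apply] at this
    exact le_trans (by positivity) this

theorem exists_radius (x : Torus n) (k : ℝ) :
    ∃ R : ℝ, 0 < R ∧ ∀ v : E n, ‖v‖ = R → L x 0 + k * R < L x v := by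
  -- With R ≥ 1, this slope times R exceeds both |L x 0| and k * R together.
  have h := (hL.coercive x).eventually_ge_atTop (|L x 0| + |k| + 1)
  obtain ⟨r, hr⟩ := (Filter.hasBasis_cocompact.eventually_iff.1 h).imp fun K hK => hK
  obtain ⟨R₀, hR₀⟩ := hr.1.isBounded.exists_norm_le
  refine ⟨max R₀ 0 + 1, by positivity, fun v hv => ?_⟩
  set R := max R₀ 0 + 1
  have hR1 : 1 ≤ R := by simp [R]
  have hvr : v ∈ rᶜ := fun hvr => by
    have := hR₀ v hvr
    have : R₀ < R := lt_of_le_of_lt (le_max_left _ 0) (lt_add_one _)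
    linarith
  have h1 := hr.2 hvr
  simp only [hv] at h1
  rw [le_div_iff₀ (by positivity)] at h1
  nlinarith [le_abs_self (L x 0), le_abs_self k, abs_nonneg (L x 0), abs_nonneg k]

/-- Coercivity is assumed only pointwise in `x`. The strict gap on a sphere persists for nearby `x`
by compactness of the sphere, convexity along rays propagates it outwards, and compactness of the
torus makes the constant global. -/
theorem superlinear (k : ℝ) : ∃ K : ℝ, ∀ x v, k * ‖v‖ - K ≤ L x v := by
  have hc := hL.continuous_uncurry
  have key : ∀ x : Torus n, ∃ U ∈ 𝓝 x, ∃ K : ℝ, ∀ y ∈ U, ∀ v, k * ‖v‖ - K ≤ L y v := by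
    intro x
    obtain ⟨R, hR, hx⟩ := hL.exists_radius x k
    have hev : ∀ᶠ y in 𝓝 x, ∀ v ∈ Metric.sphere (0 : E n) R, L y 0 + k * R < L y v := by
      refine (isCompact_sphere (0 : E n) R).eventually_forall_of_forall_eventually fun v hv => ?_
      have h1 : Continuous fun p : Torus n × E n => L p.1 0 + k * R := by fun_prop
      exact (h1.continuousAt.eventually_lt hc.continuousAt) (hx v (by simpa using hv))
    obtain ⟨m, hm⟩ := ((isCompact_univ (X := Torus n)).prod
      (isCompact_closedBall (0 : E n) R)).bddBelow_image hc.continuousOn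
    have hm' : ∀ y v, ‖v‖ ≤ R → m ≤ L y v := fun y v hv =>
      hm ⟨(y, v), by simpa using hv, rfl⟩
    refine ⟨_, hev, |k| * R + |m|, fun y hy v => ?_⟩
    rcases le_or_gt ‖v‖ R with hv | hv
    · have h1 := hm' y v hv
      have : k * ‖v‖ ≤ |k| * R :=
        mul_le_mul (le_abs_self k) hv (norm_nonneg _) (abs_nonneg _)
      linarith [neg_abs_le m]
    · have hv0 : 0 < ‖v‖ := hR.trans hv
      set s := R / ‖v‖
      have hs0 : 0 < s := by positivity
      have hs1 : s ≤ 1 := (div_le_one hv0).2 hv.le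
      have hs : s * ‖v‖ = R := div_mul_cancel₀ _ hv0.ne'
      have h1 := hy (s • v) (by simp [norm_smul, abs_of_pos hs0, hs])
      -- The point s • v lies on the sphere between 0 and v, so the mean slope from 0 to v is at
      -- least the slope from 0 to the sphere, which exceeds k.
      have h2 := (hL.convexOn_ray y v).2 (Set.mem_univ 0) (Set.mem_univ 1)
        (sub_nonneg.2 hs1) hs0.le (by ring)
      simp only [smul_eq_mul, mul_zero, mul_one, zero_add, zero_smul, one_smul] at h2
      have h3 : s * (k * ‖v‖) ≤ s * (L y v - L y 0) := by
        have : s * (k * ‖v‖) = k * R := by rw [← hs]; ring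
        nlinarith
      have h4 := le_of_mul_le_mul_left h3 hs0
      have h5 := hm' y 0 (by simpa using hR.le)
      have : 0 ≤ |k| * R := by positivity
      linarith [neg_abs_le m]
  choose U hU K hK using key
  obtain ⟨t, ht⟩ := (isCompact_univ (X := Torus n)).elim_nhds_subcover U fun x _ => hU x
  refine ⟨∑ x ∈ t, |K x|, fun y v => ?_⟩
  obtain ⟨x, hxt, hyx⟩ := Set.mem_iUnion₂.1 (ht.2 (Set.mem_univ y))
  have h1 := hK x y hyx v
  have h2 : |K x| ≤ ∑ x ∈ t, |K x| :=
    Finset.single_le_sum (f := fun x => |K x|) (fun _ _ => abs_nonneg _) hxt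
  linarith [le_abs_self (K x)]

end IsLagrangian

/-! ### Extended-valued integrals -/

section ExtIntegral

variable {α : Type*} [MeasurableSpace α] {μ : Measure α}

/-- Measurability plays no role: `∫⁻` is monotone for arbitrary functions, and so is subtraction in
`EReal` with its conventions at infinity. -/
theorem extIntegral_mono {f h : α → EReal} (hfh : ∀ a, f a ≤ h a) :
    extIntegral μ f ≤ extIntegral μ h := by
  refine EReal.sub_le_sub ?_ ?_
  · exact_mod_cast lintegral_mono fun a => EReal.toENNReal_le_toENNReal (hfh a)
  · exact_mod_cast lintegral_mono fun a =>
      EReal.toENNReal_le_toENNReal (EReal.neg_le_neg_iff.2 (hfh a))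

theorem extIntegral_coe {f : α → ℝ} (hf : Integrable f μ) :
    extIntegral μ (fun a => (f a : EReal)) = ((∫ a, f a ∂μ : ℝ) : EReal) := by
  have h1 : ∫⁻ a, ENNReal.ofReal (f a) ∂μ ≠ ⊤ := (hf.lintegral_lt_top).ne
  have h2 : ∫⁻ a, ENNReal.ofReal (-f a) ∂μ ≠ ⊤ := (hf.neg.lintegral_lt_top).ne
  rw [integral_eq_lintegral_pos_part_sub_lintegral_neg_part hf, extIntegral]
  simp only [← EReal.coe_neg, EReal.real_coe_toENNReal, EReal.coe_sub]
  rw [EReal.coe_ennreal_toReal h1, EReal.coe_ennreal_toReal h2]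

theorem extIntegral_const [IsProbabilityMeasure μ] (c : ℝ) :
    extIntegral μ (fun _ => (c : EReal)) = (c : EReal) := by
  rw [extIntegral_coe (integrable_const c)]
  simp

theorem extIntegral_eq_top [IsFiniteMeasure μ] {f : α → ℝ} (hf : AEStronglyMeasurable f μ)
    {c : ℝ} (hc : ∀ a, c ≤ f a) (hi : ¬ Integrable f μ) :
    extIntegral μ (fun a => (f a : EReal)) = ⊤ := by
  have h2 : ∫⁻ a, ENNReal.ofReal (-f a) ∂μ ≠ ⊤ := by
    refine ne_top_of_le_ne_top ?_ (lintegral_mono fun a =>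
      ENNReal.ofReal_le_ofReal (neg_le_neg (hc a)))
    simp [ENNReal.mul_eq_top]
  have h1 : ∫⁻ a, ENNReal.ofReal (f a) ∂μ = ⊤ := by
    by_contra h
    refine hi ⟨hf, ?_⟩
    have : ∀ a, ‖f a‖ₑ = ENNReal.ofReal (f a) + ENNReal.ofReal (-f a) := fun a => by
      rw [Real.enorm_eq_ofReal_abs]
      rcases le_total 0 (f a) with h0 | h0
      · rw [abs_of_nonneg h0, ENNReal.ofReal_of_nonpos (neg_nonpos.2 h0), add_zero]
      · rw [abs_of_nonpos h0, ENNReal.ofReal_of_nonpos h0, zero_add]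
    rw [HasFiniteIntegral, lintegral_congr this,
      lintegral_add_left' hf.aemeasurable.ennreal_ofReal]
    exact ENNReal.add_lt_top.2 ⟨lt_top_iff_ne_top.2 h, lt_top_iff_ne_top.2 h2⟩
  rw [extIntegral]
  simp only [← EReal.coe_neg, EReal.real_coe_toENNReal]
  rw [h1, ← EReal.coe_ennreal_toReal h2, EReal.coe_ennreal_top, EReal.top_sub_coe]

theorem extIntegral_map {β : Type*} [MeasurableSpace β] {T : α → β} (hT : Measurable T)
    {f : β → EReal} (hf : Measurable f) :
    extIntegral (μ.map T) f = extIntegral μ (fun a => f (T a)) := by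
  have hn : Measurable fun b => -f b := continuous_neg.measurable.comp hf
  rw [extIntegral, extIntegral, lintegral_map hf.ereal_toENNReal hT,
    lintegral_map hn.ereal_toENNReal hT]

end ExtIntegral

/-! ### A plan with integer jumps, admissible for every marginal -/

/-- The integer vector with coordinates `⌊Qᵢ + ω⌋`. -/
noncomputable def floorVector (Q : E n) (ω : ℝ) : E n :=
  WithLp.toLp 2 fun i => ((⌊Q i + ω⌋ : ℤ) : ℝ)

/-- The law of `floorVector Q ω` for `ω` uniformly distributed on the unit interval, a probability
measure on integer vectors with mean `Q`. -/
noncomputable def integerLaw (Q : E n) : Measure (E n) :=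
  (volume.restrict (Set.Ioc (0 : ℝ) 1)).map (floorVector Q)

theorem measurable_floorVector (Q : E n) : Measurable (floorVector Q) := by
  refine (WithLp.measurable_toLp 2 _).comp (measurable_pi_lambda _ fun i => ?_)
  exact (measurable_of_countable (fun k : ℤ => (k : ℝ))).comp
    (Int.measurable_floor.comp (measurable_const.add measurable_id))

theorem proj_floorVector (Q : E n) (ω : ℝ) : proj (floorVector Q ω) = 0 := by
  funext i
  simp only [proj, floorVector, Pi.zero_apply]
  exact (AddCircle.coe_eq_zero_iff 1).2 ⟨⌊Q i + ω⌋, by simp⟩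

instance (Q : E n) : IsProbabilityMeasure (integerLaw Q) := by
  have : IsProbabilityMeasure (volume.restrict (Set.Ioc (0 : ℝ) 1)) := ⟨by simp⟩
  exact Measure.isProbabilityMeasure_map (measurable_floorVector Q).aemeasurable

theorem ae_integerLaw {Q : E n} {p : E n → Prop} (hp : MeasurableSet {v | p v})
    (h : ∀ ω ∈ Set.Ioc (0 : ℝ) 1, p (floorVector Q ω)) : ∀ᵐ v ∂integerLaw Q, p v := by
  rw [integerLaw, ae_map_iff (measurable_floorVector Q).aemeasurable hp]
  exact (ae_restrict_iff' measurableSet_Ioc).2 (ae_of_all _ h)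

theorem ae_integerLaw_proj (Q : E n) : ∀ᵐ v ∂integerLaw Q, proj v = 0 :=
  ae_integerLaw (isClosed_singleton.preimage continuous_proj).measurableSet
    fun ω _ => proj_floorVector Q ω

theorem exists_norm_floorVector_le (Q : E n) :
    ∃ R : ℝ, ∀ ω ∈ Set.Ioc (0 : ℝ) 1, ‖floorVector Q ω‖ ≤ R := by
  have hc : IsCompact (Set.pi Set.univ fun i : Fin n => Set.Icc (Q i - 1) (Q i + 1)) :=
    isCompact_univ_pi fun i => isCompact_Icc
  obtain ⟨R, hR⟩ := (hc.image (PiLp.continuous_toLp 2 (fun _ : Fin n => ℝ))).isBounded.exists_norm_le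
  refine ⟨R, fun ω hω => hR _ ⟨_, fun i _ => ⟨?_, ?_⟩, rfl⟩⟩
  · have := Int.lt_floor_add_one (Q i + ω)
    linarith [hω.1]
  · exact (Int.floor_le _).trans (by linarith [hω.2])

theorem ae_norm_integerLaw_le (Q : E n) : ∃ R : ℝ, ∀ᵐ v ∂integerLaw Q, ‖v‖ ≤ R := by
  obtain ⟨R, hR⟩ := exists_norm_floorVector_le Q
  exact ⟨R, ae_integerLaw (measurableSet_le measurable_norm measurable_const) hR⟩

/-- Write ⌊q + ω⌋ = q + ω - fract (q + ω). By periodicity the fractional part has mean 1/2, which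
cancels the mean of ω. -/
theorem integral_floor_add (q : ℝ) : ∫ ω in Set.Ioc (0 : ℝ) 1, ((⌊q + ω⌋ : ℤ) : ℝ) = q := by
  have hper : Function.Periodic (Int.fract : ℝ → ℝ) 1 := fun x => Int.fract_add_one x
  have h1 : ∫ ω in (0 : ℝ)..1, Int.fract (q + ω) = 1 / 2 := by
    rw [intervalIntegral.integral_comp_add_left (fun x => Int.fract x), add_zero,
      hper.intervalIntegral_add_eq q 0, zero_add]
    have : ∫ x in (0 : ℝ)..1, Int.fract x = ∫ x in (0 : ℝ)..1, x := by
      refine intervalIntegral.integral_congr_Ioo_of_le zero_le_one fun x hx => ?_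
      exact Int.fract_eq_self.2 ⟨hx.1.le, hx.2⟩
    rw [this]; simp
  have hi : IntervalIntegrable (fun ω => Int.fract (q + ω)) volume 0 1 := by
    rw [intervalIntegrable_iff]
    refine Measure.integrableOn_of_bounded (M := 1) (by simp) ?_ (ae_of_all _ fun x => ?_)
    · exact (measurable_fract.comp (measurable_const.add measurable_id)).aestronglyMeasurable
    · rw [Real.norm_of_nonneg (Int.fract_nonneg _)]; exact (Int.fract_lt_one _).le
  have h2 : ∀ ω : ℝ, ((⌊q + ω⌋ : ℤ) : ℝ) = (q + ω) - Int.fract (q + ω) := fun ω => by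
    rw [Int.self_sub_fract]
  simp_rw [h2]
  rw [← intervalIntegral.integral_of_le zero_le_one, intervalIntegral.integral_sub
    (by apply Continuous.intervalIntegrable; fun_prop) hi, h1, intervalIntegral.integral_add
    (by simp) (by simp)]
  simp

theorem integrable_integerLaw (Q : E n) : Integrable (fun v => v) (integerLaw Q) := by
  obtain ⟨R, hR⟩ := ae_norm_integerLaw_le Q
  exact Integrable.of_bound (C := R) measurable_id.aestronglyMeasurable hR

theorem integral_integerLaw (Q : E n) : ∫ v, v ∂integerLaw Q = Q := by
  have hi := integrable_integerLaw Q
  ext i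
  have h1 := (EuclideanSpace.proj (𝕜 := ℝ) i).integral_comp_comm hi
  simp only [EuclideanSpace.coe_proj] at h1
  rw [← h1, integerLaw, integral_map (measurable_floorVector Q).aemeasurable
    (by fun_prop)]
  exact integral_floor_add (Q i)

/-- Integer displacements fix every point of the torus, so the holonomic constraint is trivial
whatever `θ` is. Hence Π(θ, Q) is never empty. -/
theorem isPlan_integerLaw (θ : ProbabilityMeasure (Torus n)) (Q : E n) :
    IsPlan θ Q (Kernel.const _ (integerLaw Q)) where
  markov := inferInstance
  holonomic φ := by
    rw [Measure.compProd_const]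
    refine integral_eq_zero_of_ae ?_
    have h : ∀ᵐ p ∂((θ : Measure (Torus n)).prod (integerLaw Q)), proj p.2 = 0 :=
      Measure.quasiMeasurePreserving_snd.ae (ae_integerLaw_proj Q)
    filter_upwards [h] with p hp
    simp [hp]
  integrable := by
    rw [Measure.compProd_const]
    exact (integrable_integerLaw Q).comp_snd _
  rotation := by
    rw [Measure.compProd_const]
    have := integral_map (μ := (θ : Measure (Torus n)).prod (integerLaw Q)) (φ := Prod.snd)
      measurable_snd.aemeasurable (f := fun v : E n => v)
      measurable_id.aestronglyMeasurable
    rw [← this]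
    simp [integral_integerLaw]

theorem IsLagrangian.exists_integral_integerLaw_le {L : Torus n → E n → ℝ} (hL : IsLagrangian L)
    (Q : E n) : ∃ C : ℝ, ∀ θ : ProbabilityMeasure (Torus n),
      Integrable (fun p : Torus n × E n => L p.1 p.2)
        ((θ : Measure (Torus n)) ⊗ₘ Kernel.const _ (integerLaw Q)) ∧
      ∫ p, L p.1 p.2 ∂((θ : Measure (Torus n)) ⊗ₘ Kernel.const _ (integerLaw Q)) ≤ C := by
  obtain ⟨R, hR⟩ := ae_norm_integerLaw_le Q
  obtain ⟨C, hC⟩ := (((isCompact_univ (X := Torus n)).prod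
    (isCompact_closedBall (0 : E n) R)).image hL.continuous_uncurry).isBounded.exists_norm_le
  refine ⟨C, fun θ => ?_⟩
  rw [Measure.compProd_const]
  have h : ∀ᵐ p ∂((θ : Measure (Torus n)).prod (integerLaw Q)), ‖L p.1 p.2‖ ≤ C := by
    have := Measure.quasiMeasurePreserving_snd (μ := (θ : Measure (Torus n))).ae hR
    filter_upwards [this] with p hp
    exact hC _ ⟨p, by simpa using hp, rfl⟩
  refine ⟨Integrable.of_bound hL.continuous_uncurry.aestronglyMeasurable C h, ?_⟩
  have := norm_integral_le_of_norm_le_const h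
  simp only [probReal_univ, mul_one] at this
  exact (le_abs_self _).trans this

open scoped CompactlySupported

/-! ### Extension and representation of positive functionals -/

section PositiveFunctional

variable {Z : Type*}

/-- The functions dominated by a multiple of the weight `W`. -/
def dominated (W : Z → ℝ) : Submodule ℝ (Z → ℝ) where
  carrier := {F | ∃ C : ℝ, ∀ z, |F z| ≤ C * W z}
  zero_mem' := ⟨0, fun z => by simp⟩
  add_mem' := by
    rintro F G ⟨C, hC⟩ ⟨C', hC'⟩
    refine ⟨C + C', fun z => (abs_add_le _ _).trans ?_⟩
    rw [add_mul]
    exact add_le_add (hC z) (hC' z)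
  smul_mem' := by
    rintro a F ⟨C, hC⟩
    refine ⟨|a| * C, fun z => ?_⟩
    rw [Pi.smul_apply, smul_eq_mul, abs_mul, mul_assoc]
    exact mul_le_mul_of_nonneg_left (hC z) (abs_nonneg a)

/-- A linear functional on a parameter space which is nonnegative at the parameters of nonnegative
functions is induced by a positive functional on all dominated functions. -/
theorem exists_positive_extension {Y : Type*} [AddCommGroup Y] [Module ℝ Y]
    (A : Y →ₗ[ℝ] (Z → ℝ)) (f : Y →ₗ[ℝ] ℝ) (hf : ∀ y, (∀ z, 0 ≤ A y z) → 0 ≤ f y)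
    (y₀ : Y) (hA : ∀ y, A y ∈ dominated (A y₀)) :
    ∃ Λ : dominated (A y₀) →ₗ[ℝ] ℝ, (∀ F, (∀ z, 0 ≤ F.1 z) → 0 ≤ Λ F) ∧
      ∀ y, Λ ⟨A y, hA y⟩ = f y := by
  -- Extending from Y × 0 to the product, rather than from the range of `A`, avoids checking
  -- beforehand that `f` factors through `A`.
  let s : PointedCone ℝ (Y × dominated (A y₀)) :=
    { carrier := {q | ∀ z, 0 ≤ A q.1 z + q.2.1 z}
      zero_mem' := fun z => by simp
      add_mem' := fun {a b} ha hb z => by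
        have := add_nonneg (ha z) (hb z)
        simp only [Prod.fst_add, Prod.snd_add, map_add, Pi.add_apply, Submodule.coe_add]
        linarith
      smul_mem' := fun c a ha z => by
        have := mul_nonneg c.2 (ha z)
        have e : A (c • a).1 z + (c • a).2.1 z = (c : ℝ) * (A a.1 z + a.2.1 z) := by
          rw [← Nonneg.coe_smul]
          simp only [Prod.smul_fst, Prod.smul_snd, map_smul, Pi.smul_apply, smul_eq_mul,
            Submodule.coe_smul]
          ring
        rw [e]; exact this }
  have hs : ∀ q, q ∈ s ↔ ∀ z, 0 ≤ A q.1 z + q.2.1 z := fun q => Iff.rfl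
  obtain ⟨g, hg, hpos⟩ := riesz_extension s
    ((f.comp (LinearMap.fst ℝ Y (dominated (A y₀)))).toPMap
      (LinearMap.range (LinearMap.inl ℝ Y (dominated (A y₀)))))
    (by
      rintro ⟨_, y, rfl⟩ h
      exact hf y fun z => by simpa using (hs _).1 h z)
    (by
      rintro ⟨y, F, C, hC⟩
      -- Adding this element to (y, F) gives (C • y₀, F), which is in the cone because |F| ≤ C * A
      -- y₀.
      refine ⟨⟨_, C • y₀ - y, rfl⟩, (hs _).2 fun z => ?_⟩
      have := neg_le_of_abs_le (hC z)
      simp only [LinearMap.inl_apply, Prod.mk_add_mk, sub_add_cancel, zero_add, map_smul,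
        Pi.smul_apply, smul_eq_mul]
      linarith)
  refine ⟨g.comp (LinearMap.inr ℝ Y _), fun F hF => hpos _ ((hs _).2 fun z => ?_), fun y => ?_⟩
  · simpa using hF z
  · have h1 := hg ⟨_, y, rfl⟩
    -- This vector and its opposite both lie in the cone.
    have h2 : g (y, -⟨A y, hA y⟩) = 0 := by
      refine le_antisymm ?_ (hpos _ ((hs _).2 fun z => by simp))
      have := hpos (-(y, -⟨A y, hA y⟩)) ((hs _).2 fun z => by simp)
      rw [map_neg] at this
      linarith
    have h3 : ((y, -⟨A y, hA y⟩) : Y × dominated (A y₀)) =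
        LinearMap.inl ℝ Y _ y - LinearMap.inr ℝ Y _ ⟨A y, hA y⟩ := by
      ext <;> simp
    rw [h3, map_sub, h1] at h2
    exact (sub_eq_zero.1 h2).symm

variable [TopologicalSpace Z] [T2Space Z] [LocallyCompactSpace Z] [SigmaCompactSpace Z]
  [MeasurableSpace Z] [BorelSpace Z]

/-- A positive functional on the functions dominated by `W` is represented by a measure on the
continuous functions which are negligible with respect to `W` at infinity. -/
theorem exists_representing_measure {W : Z → ℝ} (hWc : Continuous W) (hW : ∀ z, 1 ≤ W z)
    (Λ : dominated W →ₗ[ℝ] ℝ) (hΛ : ∀ F, (∀ z, 0 ≤ F.1 z) → 0 ≤ Λ F) :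
    ∃ μ : Measure Z,
      (∀ F : dominated W, Continuous F.1 → (∀ z, 0 ≤ F.1 z) →
        Integrable F.1 μ ∧ ∫ z, F.1 z ∂μ ≤ Λ F) ∧
      ∀ F : dominated W, Continuous F.1 →
        (∀ ε > 0, ∃ K, IsCompact K ∧ ∀ z ∉ K, |F.1 z| ≤ ε * W z) →
        Integrable F.1 μ ∧ ∫ z, F.1 z ∂μ = Λ F := by
  have hW0 : ∀ z, 0 ≤ W z := fun z => zero_le_one.trans (hW z)
  have hmono : ∀ F G : dominated W, (∀ z, F.1 z ≤ G.1 z) → Λ F ≤ Λ G := fun F G h => by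
    have := hΛ (G - F) fun z => by simpa using h z
    rw [map_sub] at this; linarith
  have hcc : ∀ ψ : C_c(Z, ℝ), (ψ : Z → ℝ) ∈ dominated W := fun ψ => by
    obtain ⟨C, hC⟩ := ψ.continuous.bounded_above_of_compact_support ψ.hasCompactSupport
    refine ⟨C, fun z => (hC z).trans ?_⟩
    exact le_mul_of_one_le_right ((norm_nonneg _).trans (hC z)) (hW z)
  let Λc : C_c(Z, ℝ) →ₚ[ℝ] ℝ := PositiveLinearMap.mk₀
    { toFun := fun ψ => Λ ⟨ψ, hcc ψ⟩
      map_add' := fun a b => by rw [← map_add]; rfl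
      map_smul' := fun c a => by rw [RingHom.id_apply, ← map_smul]; rfl }
    (fun ψ hψ => hΛ _ fun z => hψ z)
  let μ := RealRMK.rieszMeasure Λc
  have hrep : ∀ ψ : C_c(Z, ℝ), ∫ z, ψ z ∂μ = Λ ⟨ψ, hcc ψ⟩ :=
    fun ψ => RealRMK.integral_rieszMeasure Λc ψ
  have : μ.Regular := RealRMK.regular_rieszMeasure Λc
  -- Truncated functions have compact support, so `μ` represents Λ exactly on them.
  have cutoff : ∀ K : Set Z, IsCompact K → ∀ F : Z → ℝ, Continuous F →
      ∃ ψ : Z → ℝ, Continuous ψ ∧ (∀ z, 0 ≤ ψ z) ∧ (∀ z, ψ z ≤ 1) ∧ (∀ z ∈ K, ψ z = 1) ∧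
        ∃ hd : (fun z => F z * ψ z) ∈ dominated W,
          Integrable (fun z => F z * ψ z) μ ∧ ∫ z, F z * ψ z ∂μ = Λ ⟨_, hd⟩ := by
    intro K hK F hF
    obtain ⟨ψ, h1, -, h3, h4⟩ := exists_continuous_one_zero_of_isCompact hK isClosed_empty
      (Set.disjoint_empty K)
    let η : C_c(Z, ℝ) := ⟨⟨fun z => F z * ψ z, hF.mul ψ.continuous⟩, h3.mul_left⟩
    exact ⟨ψ, ψ.continuous, fun z => (h4 z).1, fun z => (h4 z).2, fun z hz => h1 hz, hcc η,
      η.continuous.integrable_of_hasCompactSupport η.hasCompactSupport, hrep η⟩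
  -- Exhaustion by compact sets gives only an inequality, since Λ may carry a part living at
  -- infinity.
  have key : ∀ F : dominated W, Continuous F.1 → (∀ z, 0 ≤ F.1 z) →
      ∫⁻ z, ENNReal.ofReal (F.1 z) ∂μ ≤ ENNReal.ofReal (Λ F) := by
    intro F hF h0
    rw [← setLIntegral_univ, ← iUnion_compactCovering Z, setLIntegral_iUnion_of_directed]
    · refine iSup_le fun m => ?_
      obtain ⟨ψ, hψ, hψ0, hψ1, hψK, hd, hi, he⟩ :=
        cutoff _ (isCompact_compactCovering Z m) F.1 hF
      calc ∫⁻ z in compactCovering Z m, ENNReal.ofReal (F.1 z) ∂μ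
          ≤ ∫⁻ z in compactCovering Z m, ENNReal.ofReal (F.1 z * ψ z) ∂μ := by
            refine setLIntegral_mono' (isCompact_compactCovering Z m).measurableSet
              fun z hz => ?_
            rw [hψK z hz, mul_one]
        _ ≤ ∫⁻ z, ENNReal.ofReal (F.1 z * ψ z) ∂μ := setLIntegral_le_lintegral _ _
        _ = ENNReal.ofReal (Λ ⟨_, hd⟩) := by
            rw [← he, ofReal_integral_eq_lintegral_ofReal hi
              (ae_of_all _ fun z => mul_nonneg (h0 z) (hψ0 z))]
        _ ≤ ENNReal.ofReal (Λ F) := ENNReal.ofReal_le_ofReal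
            (hmono _ _ fun z => mul_le_of_le_one_right (h0 z) (hψ1 z))
    · have h : Monotone (compactCovering Z) := fun _ _ h => compactCovering_subset Z h
      exact h.directed_le
  have part1 : ∀ F : dominated W, Continuous F.1 → (∀ z, 0 ≤ F.1 z) →
      Integrable F.1 μ ∧ ∫ z, F.1 z ∂μ ≤ Λ F := by
    intro F hF h0
    have h1 := key F hF h0
    refine ⟨(lintegral_ofReal_ne_top_iff_integrable hF.aestronglyMeasurable
      (ae_of_all _ h0)).1 (ne_top_of_le_ne_top ENNReal.ofReal_ne_top h1), ?_⟩
    rw [integral_eq_lintegral_of_nonneg_ae (ae_of_all _ h0) hF.aestronglyMeasurable]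
    exact ENNReal.toReal_le_of_le_ofReal (hΛ F h0) h1
  refine ⟨μ, part1, fun F hF hsmall => ?_⟩
  obtain ⟨C, hC⟩ := F.2
  have habs : (fun z => |F.1 z|) ∈ dominated W := ⟨C, fun z => by rw [abs_abs]; exact hC z⟩
  have hFi : Integrable F.1 μ := by
    refine ((part1 ⟨_, habs⟩ hF.abs fun z => abs_nonneg _).1).mono' hF.aestronglyMeasurable ?_
    exact ae_of_all _ fun z => le_rfl
  refine ⟨hFi, ?_⟩
  have hWd : W ∈ dominated W := ⟨1, fun z => by rw [one_mul, abs_of_nonneg (hW0 z)]⟩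
  obtain ⟨hWi, hWΛ⟩ := part1 ⟨W, hWd⟩ hWc hW0
  have hWΛ0 : 0 ≤ Λ ⟨W, hWd⟩ := hΛ _ hW0
  -- Truncating F outside K costs at most ε * Λ W in the integral and as much in Λ.
  have hbound : ∀ ε > 0, |∫ z, F.1 z ∂μ - Λ F| ≤ ε * (2 * Λ ⟨W, hWd⟩) := by
    intro ε hε
    obtain ⟨K, hK, hKF⟩ := hsmall ε hε
    obtain ⟨ψ, hψ, hψ0, hψ1, hψK, hd, hi, he⟩ := cutoff K hK F.1 hF
    have hrem : ∀ z, |F.1 z - F.1 z * ψ z| ≤ ε * W z := fun z => by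
      by_cases hz : z ∈ K
      · rw [hψK z hz, mul_one, sub_self, abs_zero]
        exact mul_nonneg hε.le (hW0 z)
      · have : F.1 z - F.1 z * ψ z = F.1 z * (1 - ψ z) := by ring
        rw [this, abs_mul, abs_of_nonneg (sub_nonneg.2 (hψ1 z))]
        exact (mul_le_of_le_one_right (abs_nonneg _) (by linarith [hψ0 z])).trans (hKF z hz)
    have hΛ1 : Λ (F - ⟨_, hd⟩) ≤ Λ (ε • ⟨W, hWd⟩) :=
      hmono _ _ fun z => (le_abs_self _).trans (hrem z)
    have hΛ2 : Λ (⟨_, hd⟩ - F) ≤ Λ (ε • ⟨W, hWd⟩) :=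
      hmono _ _ fun z => by
        refine (le_abs_self _).trans ?_
        have := hrem z
        rw [abs_sub_comm] at this
        exact this
    rw [map_sub, map_smul, smul_eq_mul] at hΛ1 hΛ2
    have hint : |∫ z, F.1 z - F.1 z * ψ z ∂μ| ≤ ∫ z, ε * W z ∂μ := by
      rw [← Real.norm_eq_abs]
      exact norm_integral_le_of_norm_le (hWi.const_mul ε) (ae_of_all _ hrem)
    rw [integral_const_mul, integral_sub hFi hi, he] at hint
    have h5 := hint.trans (mul_le_mul_of_nonneg_left hWΛ hε.le)
    rw [abs_le] at h5 ⊢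
    constructor <;> linarith [h5.1, h5.2]
  have : |∫ z, F.1 z ∂μ - Λ F| ≤ 0 := by
    refine le_of_forall_pos_le_add fun δ hδ => ?_
    -- The added 1 is needed because Λ W may vanish.
    have hpos : 0 < 2 * Λ ⟨W, hWd⟩ + 1 := by linarith
    refine (hbound (δ / (2 * Λ ⟨W, hWd⟩ + 1)) (by positivity)).trans ?_
    rw [zero_add, div_mul_eq_mul_div, div_le_iff₀ hpos]
    nlinarith
  exact sub_eq_zero.1 (abs_eq_zero.1 (le_antisymm this (abs_nonneg _)))

end PositiveFunctional

/-! ### The dual problem and weak duality -/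

/-- The constraint function with multipliers `u` and `P`. -/
noncomputable def constraint (Q P : E n) (u : C(Torus n, ℝ)) (p : Torus n × E n) : ℝ :=
  u (p.1 + proj p.2) - u p.1 + inner ℝ P (p.2 - Q)

theorem continuous_translate : Continuous fun p : Torus n × E n => p.1 + proj p.2 :=
  continuous_fst.add (continuous_proj.comp continuous_snd)

theorem continuous_constraint (Q P : E n) (u : C(Torus n, ℝ)) : Continuous (constraint Q P u) := by
  exact ((u.continuous.comp continuous_translate).sub (u.continuous.comp continuous_fst)).add
    (continuous_const.inner (continuous_snd.sub continuous_const))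

theorem abs_constraint_le (Q P : E n) (u : C(Torus n, ℝ)) (p : Torus n × E n) :
    |constraint Q P u p| ≤ (2 * ‖u‖ + ‖P‖ * (1 + ‖Q‖)) * (1 + ‖p.2‖) := by
  have h1 : |u (p.1 + proj p.2)| ≤ ‖u‖ := u.norm_coe_le_norm _
  have h2 : |u p.1| ≤ ‖u‖ := u.norm_coe_le_norm _
  have h3 : |inner ℝ P (p.2 - Q)| ≤ ‖P‖ * (‖p.2‖ + ‖Q‖) :=
    (abs_real_inner_le_norm _ _).trans
      (mul_le_mul_of_nonneg_left (norm_sub_le _ _) (norm_nonneg _))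
  have h4 : |constraint Q P u p| ≤ ‖u‖ + ‖u‖ + ‖P‖ * (‖p.2‖ + ‖Q‖) :=
    (abs_add_le _ _).trans (add_le_add ((abs_sub _ _).trans (add_le_add h1 h2)) h3)
  have := norm_nonneg u
  have := norm_nonneg p.2
  have h5 : 0 ≤ ‖u‖ * ‖p.2‖ := by positivity
  have h6 : 0 ≤ ‖P‖ * (1 + ‖Q‖ * ‖p.2‖) := by positivity
  nlinarith

theorem IsPlan.integral_constraint {θ : ProbabilityMeasure (Torus n)} {Q : E n}
    {π : Kernel (Torus n) (E n)} (hπ : IsPlan θ Q π) (P : E n) (u : C(Torus n, ℝ)) :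
    Integrable (constraint Q P u) ((θ : Measure (Torus n)) ⊗ₘ π) ∧
      ∫ p, constraint Q P u p ∂((θ : Measure (Torus n)) ⊗ₘ π) = 0 := by
  have := hπ.markov
  have hu : Integrable (fun p : Torus n × E n => u (p.1 + proj p.2) - u p.1)
      ((θ : Measure (Torus n)) ⊗ₘ π) := by
    refine Integrable.of_bound (C := ‖u‖ + ‖u‖) ?_ (ae_of_all _ fun p => ?_)
    · exact ((u.continuous.comp continuous_translate).sub
        (u.continuous.comp continuous_fst)).aestronglyMeasurable
    · exact (norm_sub_le _ _).trans (add_le_add (u.norm_coe_le_norm _) (u.norm_coe_le_norm _))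
  have hv : Integrable (fun p : Torus n × E n => p.2 - Q) ((θ : Measure (Torus n)) ⊗ₘ π) :=
    hπ.integrable.sub (integrable_const Q)
  have hP : Integrable (fun p : Torus n × E n => inner ℝ P (p.2 - Q))
      ((θ : Measure (Torus n)) ⊗ₘ π) := hv.const_inner P
  refine ⟨hu.add hP, ?_⟩
  have e : ∫ p, constraint Q P u p ∂((θ : Measure (Torus n)) ⊗ₘ π) = _ := integral_add hu hP
  rw [e, hπ.holonomic u, integral_inner hv, integral_sub hπ.integrable (integrable_const Q),
    hπ.rotation]
  simp

/-- The value of the dual problem for a fixed marginal `θ`. -/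
noncomputable def dualValue (L : Torus n → E n → ℝ) (Q : E n) (θ : ProbabilityMeasure (Torus n)) :
    EReal :=
  ⨆ (P : E n) (u : C(Torus n, ℝ)), extIntegral (θ : Measure (Torus n))
    (fun x => ⨅ v : E n, ((L x v + constraint Q P u (x, v) : ℝ) : EReal))

theorem le_dualValue (L : Torus n → E n → ℝ) (Q : E n) (θ : ProbabilityMeasure (Torus n))
    (P : E n) (u : C(Torus n, ℝ)) :
    extIntegral (θ : Measure (Torus n))
      (fun x => ⨅ v : E n, ((L x v + constraint Q P u (x, v) : ℝ) : EReal)) ≤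
      dualValue L Q θ :=
  le_iSup₂ (f := fun P u => extIntegral (θ : Measure (Torus n))
    (fun x => ⨅ v : E n, ((L x v + constraint Q P u (x, v) : ℝ) : EReal))) P u

namespace IsLagrangian

variable {L : Torus n → E n → ℝ} (hL : IsLagrangian L)
include hL

theorem measurable_iInf_add_constraint (Q P : E n) (u : C(Torus n, ℝ)) :
    Measurable fun x => ⨅ v : E n, ((L x v + constraint Q P u (x, v) : ℝ) : EReal) := by
  refine UpperSemicontinuous.measurable (upperSemicontinuous_iInf fun v => ?_)
  refine (continuous_coe_real_ereal.comp ?_).upperSemicontinuous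
  exact (hL.continuous_uncurry.add (continuous_constraint Q P u)).comp
    (continuous_id.prodMk continuous_const)

theorem exists_lower_bound : ∃ K : ℝ, ∀ x v, K ≤ L x v := by
  obtain ⟨K, hK⟩ := hL.superlinear 0
  exact ⟨-K, fun x v => by simpa using hK x v⟩

/-- The constraint has zero integral along a plan, so adding it leaves the cost unchanged, and the
infimum over `v` lies below the value at the actual velocity. A plan with non-integrable cost has
cost `⊤`, as `L` is bounded below. -/
theorem dualValue_le_g (Q : E n) (θ : ProbabilityMeasure (Torus n)) :
    dualValue L Q θ ≤ g L Q θ := by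
  refine le_iInf₂ fun π hπ => iSup₂_le fun P u => ?_
  have := hπ.markov
  obtain ⟨hi, h0⟩ := hπ.integral_constraint P u
  obtain ⟨K, hK⟩ := hL.exists_lower_bound
  have hm : AEStronglyMeasurable (fun p : Torus n × E n => L p.1 p.2)
      ((θ : Measure (Torus n)) ⊗ₘ π) := hL.continuous_uncurry.aestronglyMeasurable
  by_cases hLi : Integrable (fun p : Torus n × E n => L p.1 p.2) ((θ : Measure (Torus n)) ⊗ₘ π)
  · have e : (θ : Measure (Torus n)) = ((θ : Measure (Torus n)) ⊗ₘ π).map Prod.fst :=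
      (Measure.fst_compProd _ _).symm
    have e2 : extIntegral (θ : Measure (Torus n))
          (fun x => ⨅ v : E n, ((L x v + constraint Q P u (x, v) : ℝ) : EReal)) =
        extIntegral ((θ : Measure (Torus n)) ⊗ₘ π)
          (fun p => ⨅ v : E n, ((L p.1 v + constraint Q P u (p.1, v) : ℝ) : EReal)) := by
      rw [← extIntegral_map measurable_fst (hL.measurable_iInf_add_constraint Q P u), ← e]
    rw [e2]
    refine (extIntegral_mono (h := fun p => ((L p.1 p.2 + constraint Q P u p : ℝ) : EReal))
      fun p => iInf_le _ p.2).trans ?_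
    have hsum : Integrable (fun p : Torus n × E n => L p.1 p.2 + constraint Q P u p)
        ((θ : Measure (Torus n)) ⊗ₘ π) := hLi.add hi
    rw [extIntegral_coe hsum, extIntegral_coe hLi, integral_add hLi hi, h0, add_zero]
  · rw [extIntegral_eq_top hm (fun p => hK p.1 p.2) hLi]
    exact le_top

theorem exists_g_le (Q : E n) : ∃ C : ℝ, ∀ θ, g L Q θ ≤ C := by
  obtain ⟨C, hC⟩ := hL.exists_integral_integerLaw_le Q
  refine ⟨C, fun θ => (iInf₂_le _ (isPlan_integerLaw θ Q)).trans ?_⟩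
  rw [extIntegral_coe (hC θ).1]
  exact_mod_cast (hC θ).2

theorem exists_le_dualValue (Q : E n) : ∃ K : ℝ, ∀ θ, (K : EReal) ≤ dualValue L Q θ := by
  obtain ⟨K, hK⟩ := hL.exists_lower_bound
  refine ⟨K, fun θ => le_trans ?_ (le_dualValue L Q θ 0 0)⟩
  rw [← extIntegral_const (μ := (θ : Measure (Torus n)))]
  refine extIntegral_mono fun x => le_iInf fun v => ?_
  simpa [constraint] using hK x v

/-- A combination of constraints and of the Lagrangian which is nonnegative has a nonnegative
value, when the Lagrangian is given the value of the dual problem. -/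
theorem nonneg_of_combination_nonneg {Q : E n} {θ : ProbabilityMeasure (Torus n)} {D : ℝ}
    (hD : dualValue L Q θ = D) (φ u : C(Torus n, ℝ)) (P : E n) (c : ℝ)
    (h : ∀ p : Torus n × E n, 0 ≤ φ p.1 + constraint Q P u p + c * L p.1 p.2) :
    0 ≤ ∫ x, φ x ∂(θ : Measure (Torus n)) + c * D := by
  have hφ : Integrable φ (θ : Measure (Torus n)) :=
    φ.continuous.integrable_of_hasCompactSupport (HasCompactSupport.of_compactSpace _)
  -- For c > 0, dividing by c turns the inequality into a lower bound for the dual integrand with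
  -- multipliers P / c and u / c. For c ≤ 0, integrate it against the integer-jump plan, whose cost
  -- is at least D.
  rcases lt_or_ge 0 c with hc | hc
  · have h1 : ((∫ x, -(c⁻¹ * φ x) ∂(θ : Measure (Torus n)) : ℝ) : EReal) ≤ D := by
      have hneg : Integrable (fun x => -(c⁻¹ * φ x)) (θ : Measure (Torus n)) :=
        (hφ.const_mul c⁻¹).neg
      rw [← hD, ← extIntegral_coe hneg]
      refine le_trans (extIntegral_mono fun x => le_iInf fun v => ?_)
        (le_dualValue L Q θ (c⁻¹ • P) (c⁻¹ • u))
      have h2 := mul_nonneg (inv_nonneg.2 hc.le) (h (x, v))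
      have h3 : c⁻¹ * (φ x + constraint Q P u (x, v) + c * L x v) =
          c⁻¹ * φ x + (L x v + constraint Q (c⁻¹ • P) (c⁻¹ • u) (x, v)) := by
        simp only [constraint, ContinuousMap.smul_apply, smul_eq_mul, real_inner_smul_left]
        field_simp
        ring
      rw [h3] at h2
      exact_mod_cast neg_le_iff_add_nonneg'.2 h2
    rw [EReal.coe_le_coe_iff, integral_neg, integral_const_mul] at h1
    have h2 := mul_le_mul_of_nonneg_left h1 hc.le
    have h3 : c * -(c⁻¹ * ∫ x, φ x ∂(θ : Measure (Torus n))) =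
        -∫ x, φ x ∂(θ : Measure (Torus n)) := by field_simp
    linarith
  · obtain ⟨C, hC⟩ := hL.exists_integral_integerLaw_le Q
    obtain ⟨hi, -⟩ := hC θ
    have hplan := isPlan_integerLaw θ Q
    obtain ⟨hci, hc0⟩ := hplan.integral_constraint P u
    set μ := (θ : Measure (Torus n)) ⊗ₘ Kernel.const _ (integerLaw Q)
    have hDL : D ≤ ∫ p, L p.1 p.2 ∂μ := by
      have := (hL.dualValue_le_g Q θ).trans (iInf₂_le _ hplan)
      rw [hD, extIntegral_coe hi] at this
      exact_mod_cast this
    have e : μ.map Prod.fst = θ := Measure.fst_compProd _ _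
    have hφμ : Integrable (fun p : Torus n × E n => φ p.1) μ := by
      rw [← e] at hφ
      exact hφ.comp_measurable measurable_fst
    have hφe : ∫ p, φ p.1 ∂μ = ∫ x, φ x ∂(θ : Measure (Torus n)) := by
      rw [← e, integral_map measurable_fst.aemeasurable φ.continuous.aestronglyMeasurable]
    have h1 := integral_nonneg_of_ae (μ := μ) (ae_of_all _ h)
    have e1 : ∫ p, φ p.1 + constraint Q P u p + c * L p.1 p.2 ∂μ = _ :=
      integral_add (hφμ.add hci) (hi.const_mul c)
    rw [e1, integral_add hφμ hci, hc0, hφe,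
      integral_const_mul, add_zero] at h1
    linarith [mul_le_mul_of_nonpos_left hDL hc]

end IsLagrangian

/-- The combination of a function of `x`, of constraint functions and of the Lagrangian, as a
linear function of its coefficients. -/
noncomputable def combination (L : Torus n → E n → ℝ) (Q : E n) :
    (C(Torus n, ℝ) × C(Torus n, ℝ) × E n × ℝ) →ₗ[ℝ] (Torus n × E n → ℝ) where
  toFun y p := y.1 p.1 + constraint Q y.2.2.1 y.2.1 p + y.2.2.2 * L p.1 p.2
  map_add' y y' := by
    funext p
    simp only [constraint, Prod.fst_add, Prod.snd_add, ContinuousMap.add_apply, inner_add_left,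
      Pi.add_apply]
    ring
  map_smul' a y := by
    funext p
    simp only [constraint, Prod.smul_fst, Prod.smul_snd, ContinuousMap.smul_apply, smul_eq_mul,
      real_inner_smul_left, Pi.smul_apply, RingHom.id_apply]
    ring

/-- The value of a combination, when constraints have value zero and the Lagrangian value `D`. -/
noncomputable def combinationValue (θ : ProbabilityMeasure (Torus n)) (D : ℝ) :
    (C(Torus n, ℝ) × C(Torus n, ℝ) × E n × ℝ) →ₗ[ℝ] ℝ where
  toFun y := ∫ x, y.1 x ∂(θ : Measure (Torus n)) + y.2.2.2 * D
  map_add' y y' := by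
    have h : ∀ φ : C(Torus n, ℝ), Integrable φ (θ : Measure (Torus n)) := fun φ =>
      φ.continuous.integrable_of_hasCompactSupport (HasCompactSupport.of_compactSpace _)
    simp only [Prod.fst_add, Prod.snd_add, ContinuousMap.add_apply]
    rw [integral_add (h _) (h _)]
    ring
  map_smul' a y := by
    simp only [Prod.smul_fst, Prod.smul_snd, ContinuousMap.smul_apply, smul_eq_mul,
      RingHom.id_apply]
    rw [integral_const_mul]
    ring

/-! ### Strong duality for a fixed marginal -/

namespace IsLagrangian

variable {L : Torus n → E n → ℝ} (hL : IsLagrangian L)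
include hL

theorem small_at_infinity (K C : ℝ) {ε : ℝ} (hε : 0 < ε) :
    ∃ B : Set (Torus n × E n), IsCompact B ∧
      ∀ p ∉ B, C * (1 + ‖p.2‖) ≤ ε * (L p.1 p.2 + K) := by
  -- Slope C + 1 instead of C leaves a surplus ‖v‖, which absorbs the constants outside a large
  -- ball.
  obtain ⟨K', hK'⟩ := hL.superlinear ((C + 1) / ε)
  refine ⟨Set.univ ×ˢ Metric.closedBall 0 (C + ε * K' - ε * K),
    isCompact_univ.prod (isCompact_closedBall _ _), fun p hp => ?_⟩
  have hp' : C + ε * K' - ε * K < ‖p.2‖ := by simpa using hp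
  have h1 := mul_le_mul_of_nonneg_left (hK' p.1 p.2) hε.le
  have h2 : ε * ((C + 1) / ε * ‖p.2‖ - K') = (C + 1) * ‖p.2‖ - ε * K' := by
    field_simp
  linarith

/-- Existence of an optimal plan, whose cost is at most the value of the dual problem. -/
theorem exists_isPlan {Q : E n} {θ : ProbabilityMeasure (Torus n)} {D : ℝ}
    (hD : dualValue L Q θ = D) :
    ∃ π : Kernel (Torus n) (E n), IsPlan θ Q π ∧
      Integrable (fun p : Torus n × E n => L p.1 p.2) ((θ : Measure (Torus n)) ⊗ₘ π) ∧
      ∫ p, L p.1 p.2 ∂((θ : Measure (Torus n)) ⊗ₘ π) ≤ D := by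
  obtain ⟨K₁, hK₁⟩ := hL.superlinear 1
  -- With this shift the weight L + K dominates 1 + ‖v‖, hence every constraint function, and it is
  -- itself a combination, with coefficients `y₀`.
  obtain ⟨K, hK⟩ : ∃ K, K = K₁ + 1 := ⟨_, rfl⟩
  have hWv : ∀ p : Torus n × E n, 1 + ‖p.2‖ ≤ L p.1 p.2 + K := fun p => by
    linarith [hK₁ p.1 p.2]
  let y₀ : C(Torus n, ℝ) × C(Torus n, ℝ) × E n × ℝ := (ContinuousMap.const _ K, 0, 0, 1)
  have hy₀ : ∀ p, combination L Q y₀ p = L p.1 p.2 + K := fun p => by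
    simp [combination, y₀, constraint, add_comm]
  have hdom : ∀ F : Torus n × E n → ℝ, ∀ C, 0 ≤ C → (∀ p, |F p| ≤ C * (1 + ‖p.2‖)) →
      F ∈ dominated (combination L Q y₀) := fun F C hC h =>
    ⟨C, fun p => (h p).trans (by
      rw [hy₀]; exact mul_le_mul_of_nonneg_left (hWv p) hC)⟩
  have hφdom : ∀ φ : C(Torus n, ℝ), ∀ p : Torus n × E n, |φ p.1| ≤ ‖φ‖ * (1 + ‖p.2‖) :=
    fun φ p => (φ.norm_coe_le_norm p.1).trans
      (le_mul_of_one_le_right (norm_nonneg _) (by linarith [norm_nonneg p.2]))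
  have hA : ∀ y, combination L Q y ∈ dominated (combination L Q y₀) := by
    rintro ⟨φ, u, P, c⟩
    have h1 : (fun p : Torus n × E n => φ p.1) ∈ dominated (combination L Q y₀) :=
      hdom _ _ (norm_nonneg _) (hφdom φ)
    have h2 : constraint Q P u ∈ dominated (combination L Q y₀) :=
      hdom _ _ (by positivity) (abs_constraint_le Q P u)
    have h3 : (fun p : Torus n × E n => L p.1 p.2) ∈ dominated (combination L Q y₀) := by
      refine ⟨1 + |K|, fun p => ?_⟩
      rw [hy₀]
      have := hWv p
      have := norm_nonneg p.2
      have hk : 0 ≤ |K| * (L p.1 p.2 + K - 1) := mul_nonneg (abs_nonneg _) (by linarith)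
      rw [abs_le]
      constructor <;> nlinarith [le_abs_self K, neg_abs_le K]
    exact add_mem (add_mem h1 h2) (Submodule.smul_mem _ c h3)
  obtain ⟨Λ, hΛ, hΛA⟩ := exists_positive_extension (combination L Q) (combinationValue θ D)
    (fun y hy => hL.nonneg_of_combination_nonneg hD y.1 y.2.1 y.2.2.1 y.2.2.2 hy) y₀ hA
  have hLc := hL.continuous_uncurry
  have hWeq : combination L Q y₀ = fun p => L p.1 p.2 + K := funext hy₀
  have hWc : Continuous (combination L Q y₀) := by rw [hWeq]; exact hLc.add continuous_const
  have hW1 : ∀ p, 1 ≤ combination L Q y₀ p := fun p => by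
    rw [hy₀]; linarith [hWv p, norm_nonneg p.2]
  obtain ⟨μ, hμ1, hμ2⟩ := exists_representing_measure hWc hW1 Λ hΛ
  have hrep : ∀ y (F : Torus n × E n → ℝ) (C : ℝ), combination L Q y = F → Continuous F →
      (∀ p, |F p| ≤ C * (1 + ‖p.2‖)) →
      Integrable F μ ∧ ∫ p, F p ∂μ = combinationValue θ D y := by
    rintro y F C rfl hF hC
    rw [← hΛA y]
    refine hμ2 ⟨_, hA y⟩ hF fun ε hε => ?_
    obtain ⟨B, hB, h⟩ := hL.small_at_infinity K C hε
    exact ⟨B, hB, fun p hp => (hC p).trans (by rw [hy₀]; exact h p hp)⟩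
  have hφ : ∀ φ : C(Torus n, ℝ), Integrable (fun p : Torus n × E n => φ p.1) μ ∧
      ∫ p, φ p.1 ∂μ = ∫ x, φ x ∂(θ : Measure (Torus n)) := fun φ => by
    have := hrep (φ, 0, 0, 0) (fun p => φ p.1) ‖φ‖ (by funext p; simp [combination, constraint])
      (φ.continuous.comp continuous_fst) (hφdom φ)
    simpa [combinationValue] using this
  have hconstr : ∀ P u, Integrable (constraint Q P u) μ ∧ ∫ p, constraint Q P u p ∂μ = 0 :=
    fun P u => by
    have := hrep (0, u, P, 0) (constraint Q P u) _ (by funext p; simp [combination])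
      (continuous_constraint Q P u) (abs_constraint_le Q P u)
    simpa [combinationValue] using this
  have hfin : IsFiniteMeasure μ := by
    have := (hφ 1).1
    simpa [integrable_const_iff] using this
  -- Functions of `x` alone were included among the combinations precisely to fix this marginal.
  have hfst : μ.fst = θ := by
    refine ext_of_forall_integral_eq_of_IsFiniteMeasure fun φ => ?_
    rw [Measure.fst, integral_map measurable_fst.aemeasurable
      φ.continuous.aestronglyMeasurable]
    exact (hφ φ.toContinuousMap).2
  have hdis : (θ : Measure (Torus n)) ⊗ₘ μ.condKernel = μ := by
    rw [← hfst]; exact μ.disintegrate μ.condKernel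
  -- The weight is not negligible with respect to itself at infinity, so only the inequality is
  -- available; it is the one required.
  obtain ⟨hWi, hWint⟩ := hμ1 ⟨_, hA y₀⟩ hWc fun p => zero_le_one.trans (hW1 p)
  rw [hΛA] at hWint
  simp only [hWeq] at hWi hWint
  have hLi : Integrable (fun p : Torus n × E n => L p.1 p.2) μ := by
    simpa [Pi.sub_def] using hWi.sub (integrable_const K)
  have hmass : μ.real Set.univ = 1 := by
    have := (hφ 1).2
    simpa using this
  have hvi : Integrable (fun p : Torus n × E n => p.2) μ := by
    refine hWi.mono' continuous_snd.aestronglyMeasurable (ae_of_all _ fun p => ?_)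
    linarith [hWv p]
  refine ⟨μ.condKernel, ⟨inferInstance, ?_, ?_, ?_⟩, ?_, ?_⟩
  all_goals rw [hdis]
  · intro φ
    have := (hconstr 0 φ).2
    simpa [constraint] using this
  · exact hvi
  · have hsub : Integrable (fun p : Torus n × E n => p.2 - Q) μ := hvi.sub (integrable_const Q)
    have h1 : ∀ P : E n, inner ℝ P (∫ p, p.2 ∂μ - Q) = 0 := fun P => by
      have h2 := (hconstr P 0).2
      simp only [constraint, ContinuousMap.zero_apply, sub_self, zero_add] at h2
      rw [integral_inner hsub, integral_sub hvi (integrable_const Q), integral_const, hmass,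
        one_smul] at h2
      exact h2
    exact sub_eq_zero.1 (inner_self_eq_zero.1 (h1 _))
  · exact hLi
  · rw [integral_add hLi (integrable_const K), integral_const, hmass, one_smul] at hWint
    have hval : combinationValue θ D y₀ = K + D := by simp [combinationValue, y₀]
    linarith

theorem dualValue_eq_g (Q : E n) (θ : ProbabilityMeasure (Torus n)) :
    dualValue L Q θ = g L Q θ := by
  refine le_antisymm (hL.dualValue_le_g Q θ) ?_
  obtain ⟨C, hC⟩ := hL.exists_g_le Q
  obtain ⟨K, hK⟩ := hL.exists_le_dualValue Q
  have htop : dualValue L Q θ ≠ ⊤ :=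
    ne_top_of_le_ne_top (EReal.coe_ne_top C) ((hL.dualValue_le_g Q θ).trans (hC θ))
  have hbot : dualValue L Q θ ≠ ⊥ := ne_bot_of_le_ne_bot (EReal.coe_ne_bot K) (hK θ)
  obtain ⟨π, hπ, hi, hle⟩ := hL.exists_isPlan (EReal.coe_toReal htop hbot).symm
  refine (iInf₂_le π hπ).trans ?_
  rw [extIntegral_coe hi, ← EReal.coe_toReal htop hbot]
  exact_mod_cast hle

end IsLagrangian

end MinimaxMather

theorem theorem5p3 {n : ℕ} (L : MinimaxMather.Torus n → MinimaxMather.E n → ℝ)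
    (hL : MinimaxMather.IsLagrangian L) (Q : MinimaxMather.E n) :
    MinimaxMather.hatL L Q ≠ ⊥ ∧ MinimaxMather.hatL L Q ≠ ⊤ ∧
    MinimaxMather.hatL L Q =
      ⨆ (θ : ProbabilityMeasure (MinimaxMather.Torus n)) (P : MinimaxMather.E n)
        (u : C(MinimaxMather.Torus n, ℝ)),
        MinimaxMather.extIntegral (θ : Measure (MinimaxMather.Torus n)) (fun x =>
          ⨅ v : MinimaxMather.E n,
            ((L x v + u (x + MinimaxMather.proj v) - u x + inner ℝ P (v - Q) : ℝ) : EReal)) := by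
  obtain ⟨C, hC⟩ := hL.exists_g_le Q
  obtain ⟨K, hK⟩ := hL.exists_le_dualValue Q
  refine ⟨ne_bot_of_le_ne_bot (EReal.coe_ne_bot K) ?_,
    ne_top_of_le_ne_top (EReal.coe_ne_top C) (iSup_le hC), ?_⟩
  -- Any probability measure would serve here.
  · let θ : ProbabilityMeasure (MinimaxMather.Torus n) := ⟨Measure.dirac 0, inferInstance⟩
    exact ((hK θ).trans (hL.dualValue_le_g Q θ)).trans (le_iSup _ θ)
  · refine iSup_congr fun θ => ?_
    rw [← hL.dualValue_eq_g Q θ, MinimaxMather.dualValue]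
    simp only [MinimaxMather.constraint, add_sub_assoc, add_assoc]
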